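/- Let $(x,y_0,y_1,\dots,y_n)$ be jointly Gaussian, zero-mean random vectors in $\mathbb R^{d_x},\mathbb R^{d_y^0},\mathbb R^{d_y^1},\dots,\mathbb R^{d_y^n}$ (degenerate covariances allowed), let $S=[S_{ij}]_{i,j=1}^n$ be a symmetric positive definite matrix with blocks $S_{ij}\in\mathbb R^{d_z^i\times d_z^j}$, and let $L$ be a matrix with block rows $L_i\in\mathbb R^{d_z^i\times d_x}$, $i=1,\dots,n$. A strategy is a tuple $g=(g_1,\dots,g_n)$ of Borel measurable maps; agent $i$ estimates $\hat z_i=g_i(y_0,y_i)\in\mathbb R^{d_z^i}$. With $\hat z=\operatorname{vec}(\hat z_1,\dots,\hat z_n)$, let $$J(g)=\mathbb E\big[(Lx-\hat z)^{\mathsf T}S(Lx-\hat z)\big]\in[0,\infty],\qquad J^*=\inf_g J(g),$$ the infimum being over all strategies; $g$ is optimal if $J(g)\le J(g')$ for every strategy $g'$. Put $\hat x_0=\mathbb E[x\mid y_0]$, $\tilde y_i=y_i-\mathbb E[y_i\mid y_0]$, $\hat\Theta_i=\operatorname{Cov}(x,\tilde y_i)$, $\hat\Sigma_{ij}=\operatorname{Cov}(\tilde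 y_i,\tilde y_j)$ and $P_0=\operatorname{Var}(x-\hat x_0)$. Consider, for unknown matrices $F_i\in\mathbb R^{d_z^i\times d_y^i}$, the system $$\sum_{j=1}^n\big[S_{ij}F_j\hat\Sigma_{ji}-S_{ij}L_j\hat\Theta_i\big]=0,\qquad i=1,\dots,n.\tag{1}$$ (a) The system (1) has a solution, and for every solution $(F_i)$ there is an optimal strategy, linear in the measurements (i.e. $g_i(y_0,y_i)=A_iy_0+B_iy_i$), whose estimates are almost surely $$\hat z_i=L_i\hat x_0+F_i\tilde y_i,\qquad i=1,\dots,n.\tag{2}$$ Moreover, the estimates of an arbitrary optimal strategy have the form (2) almost surely with given matrices $(F_i)$ if and only if $(F_i)$ solves (1); in particular the optimal estimates are almost surely unique. (b) Suppose that $\hat\Sigma_{ii}$ is positive definite for all $i$. Let $\Gamma=[\Gamma_{ij}]_{i,j=1}^n$ with $\Gamma_{ij}=\hat\Sigma_{ij}\otimes S_{ij}$, and $\eta=\operatorname{vec}(S_{1\bullet}L\hat\Theta_1,\dots,S_{n\bullet}L\hat\Theta_n)$, where $S_{i\bullet}=[S_{i1},\dots,S_{in}]$ and $\operatorname{vec}$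 stacks the columns of its arguments, one argument after the other. Then $\Gamma$ is invertible, (1) has exactly one solution, it is given by $\operatorname{vec}(F_1,\dots,F_n)=\Gamma^{-1}\eta$, and $$J^*=\operatorname{Tr}(L^{\mathsf T}SLP_0)-\eta^{\mathsf T}\Gamma^{-1}\eta .$$ -/

import Mathlib

open MeasureTheory ProbabilityTheory
open scoped ENNReal Matrix Kronecker

namespace TeamEstimation

noncomputable section

/-- The cross-covariance matrix `COV(u, v)` of two random vectors. -/
def crossCov {Ω : Type*} [MeasurableSpace Ω] (P : Measure Ω) {k l : ℕ}
    (u : Ω → Fin k → ℝ) (v : Ω → Fin l → ℝ) : Matrix (Fin k) (Fin l) ℝ :=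
  Matrix.of fun a b => covariance (fun ω => u ω a) (fun ω => v ω b) P

/-- The common estimate `E[u | y₀]`: conditional expectation given the sigma-algebra
generated by the common measurement. -/
def commonEst {Ω : Type*} [MeasurableSpace Ω] (P : Measure Ω) {d0 k : ℕ}
    (y0 : Ω → Fin d0 → ℝ) (u : Ω → Fin k → ℝ) : Ω → Fin k → ℝ :=
  condExp (MeasurableSpace.comap y0 inferInstance) P u

/-- The innovation `u - E[u | y₀]`. -/
def innovation {Ω : Type*} [MeasurableSpace Ω] (P : Measure Ω) {d0 k : ℕ}
    (y0 : Ω → Fin d0 → ℝ) (u : Ω → Fin k → ℝ) : Ω → Fin k → ℝ :=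
  fun ω => u ω - commonEst P y0 u ω

/-- `Σ̂ᵢⱼ`, the covariance of the innovations of agents `i` and `j`. -/
def SigmaHat {Ω : Type*} [MeasurableSpace Ω] (P : Measure Ω) {n d0 : ℕ} {dy : Fin n → ℕ}
    (y0 : Ω → Fin d0 → ℝ) (y : ∀ i, Ω → Fin (dy i) → ℝ) (i j : Fin n) :
    Matrix (Fin (dy i)) (Fin (dy j)) ℝ :=
  crossCov P (innovation P y0 (y i)) (innovation P y0 (y j))

/-- `Θ̂ᵢ`, the covariance of the state and the innovation of agent `i`. -/
def ThetaHat {Ω : Type*} [MeasurableSpace Ω] (P : Measure Ω) {n dx d0 : ℕ} {dy : Fin n → ℕ}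
    (x : Ω → Fin dx → ℝ) (y0 : Ω → Fin d0 → ℝ) (y : ∀ i, Ω → Fin (dy i) → ℝ) (i : Fin n) :
    Matrix (Fin dx) (Fin (dy i)) ℝ :=
  crossCov P x (innovation P y0 (y i))

/-- `P₀`, the covariance of the common estimation error `x - E[x | y₀]`. -/
def errorCov {Ω : Type*} [MeasurableSpace Ω] (P : Measure Ω) {dx d0 : ℕ}
    (x : Ω → Fin dx → ℝ) (y0 : Ω → Fin d0 → ℝ) : Matrix (Fin dx) (Fin dx) ℝ :=
  crossCov P (innovation P y0 x) (innovation P y0 x)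

/-- The `i`-th block row of a matrix whose rows are grouped by agent. -/
def rowBlock {n : ℕ} {dz : Fin n → ℕ} {κ : Type*}
    (M : Matrix (Σ i, Fin (dz i)) κ ℝ) (i : Fin n) : Matrix (Fin (dz i)) κ ℝ :=
  Matrix.of fun a b => M ⟨i, a⟩ b

/-- The `(i, j)` block of a matrix whose rows and columns are grouped by agent. -/
def block {n : ℕ} {dz : Fin n → ℕ}
    (S : Matrix (Σ i, Fin (dz i)) (Σ i, Fin (dz i)) ℝ) (i j : Fin n) :
    Matrix (Fin (dz i)) (Fin (dz j)) ℝ :=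
  Matrix.of fun a b => S ⟨i, a⟩ ⟨j, b⟩

/-- The team estimation error `c(x, ẑ) = (L x - ẑ)ᵀ S (L x - ẑ)`, with `ẑ` the stacked vector
of the estimates of all agents. -/
def teamError {n dx : ℕ} {dz : Fin n → ℕ}
    (S : Matrix (Σ i, Fin (dz i)) (Σ i, Fin (dz i)) ℝ) (L : Matrix (Σ i, Fin (dz i)) (Fin dx) ℝ)
    (x : Fin dx → ℝ) (z : ∀ i, Fin (dz i) → ℝ) : ℝ :=
  (L *ᵥ x - fun p => z p.1 p.2) ⬝ᵥ (S *ᵥ (L *ᵥ x - fun p => z p.1 p.2))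

/-- An estimation strategy: agent `i` uses a (Borel measurable) rule `ẑᵢ = gᵢ(y₀, yᵢ)`. -/
structure Strategy {n : ℕ} (d0 : ℕ) (dy dz : Fin n → ℕ) where
  /-- The estimation rule of each agent. -/
  rule : ∀ i, (Fin d0 → ℝ) → (Fin (dy i) → ℝ) → (Fin (dz i) → ℝ)
  measurable_rule : ∀ i, Measurable fun p : (Fin d0 → ℝ) × (Fin (dy i) → ℝ) => rule i p.1 p.2

/-- The estimate `ẑᵢ` of agent `i` under the strategy `g`, as a random vector. -/
def Strategy.estimate {Ω : Type*} {n d0 : ℕ} {dy dz : Fin n → ℕ} (g : Strategy d0 dy dz)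
    (y0 : Ω → Fin d0 → ℝ) (y : ∀ i, Ω → Fin (dy i) → ℝ) (i : Fin n) : Ω → Fin (dz i) → ℝ :=
  fun ω => g.rule i (y0 ω) (y i ω)

/-- Every estimation rule is a linear function of the measurements. -/
def Strategy.IsLinear {n d0 : ℕ} {dy dz : Fin n → ℕ} (g : Strategy d0 dy dz) : Prop :=
  ∃ (A : ∀ i, Matrix (Fin (dz i)) (Fin d0) ℝ) (B : ∀ i, Matrix (Fin (dz i)) (Fin (dy i)) ℝ),
    ∀ i u v, g.rule i u v = A i *ᵥ u + B i *ᵥ v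

/-- The expected team estimation error `J(g)`, in `[0, ∞]`: the integrand is non-negative
when `S` is positive definite, and need not be integrable for a general strategy. -/
def cost {Ω : Type*} [MeasurableSpace Ω] (P : Measure Ω) {n dx d0 : ℕ} {dy dz : Fin n → ℕ}
    (S : Matrix (Σ i, Fin (dz i)) (Σ i, Fin (dz i)) ℝ) (L : Matrix (Σ i, Fin (dz i)) (Fin dx) ℝ)
    (x : Ω → Fin dx → ℝ) (y0 : Ω → Fin d0 → ℝ) (y : ∀ i, Ω → Fin (dy i) → ℝ)
    (g : Strategy d0 dy dz) : ℝ≥0∞ :=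
  ∫⁻ ω, ENNReal.ofReal (teamError S L (x ω) fun i => g.estimate y0 y i ω) ∂P

/-- `g` minimizes the expected team estimation error among all strategies. -/
def IsOptimal {Ω : Type*} [MeasurableSpace Ω] (P : Measure Ω) {n dx d0 : ℕ} {dy dz : Fin n → ℕ}
    (S : Matrix (Σ i, Fin (dz i)) (Σ i, Fin (dz i)) ℝ) (L : Matrix (Σ i, Fin (dz i)) (Fin dx) ℝ)
    (x : Ω → Fin dx → ℝ) (y0 : Ω → Fin d0 → ℝ) (y : ∀ i, Ω → Fin (dy i) → ℝ)
    (g : Strategy d0 dy dz) : Prop :=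
  ∀ g' : Strategy d0 dy dz, cost P S L x y0 y g ≤ cost P S L x y0 y g'

/-- The minimum team mean-squared error `J*`, the infimum of `J` over all strategies. -/
def minCost {Ω : Type*} [MeasurableSpace Ω] (P : Measure Ω) {n dx d0 : ℕ} {dy dz : Fin n → ℕ}
    (S : Matrix (Σ i, Fin (dz i)) (Σ i, Fin (dz i)) ℝ) (L : Matrix (Σ i, Fin (dz i)) (Fin dx) ℝ)
    (x : Ω → Fin dx → ℝ) (y0 : Ω → Fin d0 → ℝ) (y : ∀ i, Ω → Fin (dy i) → ℝ) : ℝ≥0∞ :=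
  ⨅ g : Strategy d0 dy dz, cost P S L x y0 y g

/-- The estimates of `g` are `ẑᵢ = Lᵢ x̂₀ + Fᵢ ỹᵢ` almost surely, for every agent `i`. -/
def HasGains {Ω : Type*} [MeasurableSpace Ω] (P : Measure Ω) {n dx d0 : ℕ} {dy dz : Fin n → ℕ}
    (L : Matrix (Σ i, Fin (dz i)) (Fin dx) ℝ)
    (x : Ω → Fin dx → ℝ) (y0 : Ω → Fin d0 → ℝ) (y : ∀ i, Ω → Fin (dy i) → ℝ)
    (g : Strategy d0 dy dz) (F : ∀ i, Matrix (Fin (dz i)) (Fin (dy i)) ℝ) : Prop :=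
  ∀ i, ∀ᵐ ω ∂P, g.estimate y0 y i ω =
    rowBlock L i *ᵥ commonEst P y0 x ω + F i *ᵥ innovation P y0 (y i) ω

/-- The coupled matrix equations `∑ⱼ (Sᵢⱼ Fⱼ Σ̂ⱼᵢ - Sᵢⱼ Lⱼ Θ̂ᵢ) = 0` for all `i`. -/
def SolvesGainEq {Ω : Type*} [MeasurableSpace Ω] (P : Measure Ω) {n dx d0 : ℕ}
    {dy dz : Fin n → ℕ}
    (S : Matrix (Σ i, Fin (dz i)) (Σ i, Fin (dz i)) ℝ) (L : Matrix (Σ i, Fin (dz i)) (Fin dx) ℝ)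
    (x : Ω → Fin dx → ℝ) (y0 : Ω → Fin d0 → ℝ) (y : ∀ i, Ω → Fin (dy i) → ℝ)
    (F : ∀ i, Matrix (Fin (dz i)) (Fin (dy i)) ℝ) : Prop :=
  ∀ i, ∑ j, (block S i j * F j * SigmaHat P y0 y j i
    - block S i j * rowBlock L j * ThetaHat P x y0 y i) = 0

/-- `vec(F₁, …, Fₙ)`: the column-stacked matrices, stacked over the agents. An index
`⟨i, (b, a)⟩` is column `b`, row `a` of the `i`-th matrix. -/
def stackVec {n : ℕ} {dy dz : Fin n → ℕ} (F : ∀ i, Matrix (Fin (dz i)) (Fin (dy i)) ℝ) :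
    (Σ i, Fin (dy i) × Fin (dz i)) → ℝ :=
  fun p => Matrix.vec (F p.1) p.2

/-- The block matrix `Γ` with blocks `Γᵢⱼ = Σ̂ᵢⱼ ⊗ Sᵢⱼ`. -/
def Gam {Ω : Type*} [MeasurableSpace Ω] (P : Measure Ω) {n d0 : ℕ} {dy dz : Fin n → ℕ}
    (S : Matrix (Σ i, Fin (dz i)) (Σ i, Fin (dz i)) ℝ)
    (y0 : Ω → Fin d0 → ℝ) (y : ∀ i, Ω → Fin (dy i) → ℝ) :
    Matrix (Σ i, Fin (dy i) × Fin (dz i)) (Σ i, Fin (dy i) × Fin (dz i)) ℝ :=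
  Matrix.of fun p q => (SigmaHat P y0 y p.1 q.1 ⊗ₖ block S p.1 q.1) p.2 q.2

/-- `η = vec(S₁• L Θ̂₁, …, Sₙ• L Θ̂ₙ)`, with `Sᵢ•` the `i`-th block row of `S`. -/
def eta {Ω : Type*} [MeasurableSpace Ω] (P : Measure Ω) {n dx d0 : ℕ} {dy dz : Fin n → ℕ}
    (S : Matrix (Σ i, Fin (dz i)) (Σ i, Fin (dz i)) ℝ) (L : Matrix (Σ i, Fin (dz i)) (Fin dx) ℝ)
    (x : Ω → Fin dx → ℝ) (y0 : Ω → Fin d0 → ℝ) (y : ∀ i, Ω → Fin (dy i) → ℝ) :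
    (Σ i, Fin (dy i) × Fin (dz i)) → ℝ :=
  stackVec fun i => rowBlock S i * L * ThetaHat P x y0 y i

end

end TeamEstimation

/-! Joint Gaussianity reduces the problem to a projection. Write `x = A₀ y₀ + X` and `yᵢ = Aᵢ y₀ +
Yᵢ`, with `X` and `Yᵢ` uncorrelated with `y₀`. For Gaussian vectors this means independent, so `A₀
y₀` and `Aᵢ y₀` are the conditional expectations and `X`, `Yᵢ` the innovations. For any gains `F`
the error of a strategy is `r - d`, where `r = L X - vec(Fᵢ Yᵢ)` does not depend on the strategy and
`dᵢ`, the deviation from `Lᵢ A₀ y₀ + Fᵢ Yᵢ`, is a function of `(y₀, yᵢ)` alone.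

The gain equations say that block `i` of `S r` is uncorrelated with `Yᵢ`; it is always uncorrelated
with `y₀`. By Gaussianity that block is independent of `(y₀, yᵢ)`, hence orthogonal to `dᵢ`,
nonlinear or not (`integral_weightedResidual_mul_eq_zero`). Since `E[(S r) ⬝ d]` only pairs block
`i` of `S r` with `dᵢ`, the cross term vanishes although the agents have different information, and
`J(g) = E[rᵀ S r] + E[dᵀ S d]` in `[0, ∞]` (`cost_eq`). As `S` is positive definite, the optimal
strategies are exactly those with `d = 0` almost surely.

In vectorised form the gain equations are `Γ v = η`, and `Γ` is the Gram matrix of the form `F ↦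
E[(F Y)ᵀ S (F Y)]`. Its kernel consists of gains with `F Y = 0` almost surely, and `η` annihilates
these because `η ⬝ v = E[(S L X) ⬝ F Y]`; this gives solvability with degenerate covariances too. If
every `Σ̂ᵢᵢ` is positive definite, the kernel is trivial. The minimum is `E[rᵀ S r]`, evaluated with
the same orthogonality. -/

/-- A symmetric real system `C a = b` is solvable when `b` is orthogonal to the kernel of `C`. -/
theorem Matrix.IsSymm.exists_mulVec_eq {ι : Type*} [Fintype ι] {C : Matrix ι ι ℝ}
    (hC : C.IsSymm) {b : ι → ℝ} (h : ∀ v, C *ᵥ v = 0 → b ⬝ᵥ v = 0) : ∃ a, C *ᵥ a = b := by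
  classical
  have hb : dotProductBilin ℝ ℝ b ∈ C.mulVecLin.ker.dualAnnihilator := by
    rw [Submodule.mem_dualAnnihilator]
    intro v hv
    exact h v (by simpa using hv)
  -- The annihilator of the kernel is the range of the dual map, so `b` pairs as `f ∘ C`. The values
  -- of `f` on the standard basis form a vector `a` with `Cᵀ a = b`, and `C` is symmetric.
  rw [← LinearMap.range_dualMap_eq_dualAnnihilator_ker] at hb
  obtain ⟨f, hf⟩ := hb
  refine ⟨fun i => f (Pi.single i 1), ?_⟩
  have key : ∀ w, f w = (fun i => f (Pi.single i 1)) ⬝ᵥ w := by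
    intro w
    rw [LinearMap.pi_apply_eq_sum_univ f w]
    simp only [dotProduct, smul_eq_mul, mul_comm]
    refine Finset.sum_congr rfl fun i _ => ?_
    congr 2
    ext j
    simp [Pi.single_apply, eq_comm]
  ext i
  have := congrArg (fun g => g (Pi.single i 1)) hf
  simp only [LinearMap.dualMap_apply, Matrix.mulVecLin_apply, dotProductBilin_apply_apply,
    dotProduct_single, mul_one] at this
  rw [← this, key, Matrix.dotProduct_mulVec, dotProduct_single, mul_one, ← Matrix.mulVec_transpose,
    hC.eq]

namespace TeamEstimation

/-! ### Square-integrable vectors and linear least squares -/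

section SecondOrder

variable {Ω : Type*} [MeasurableSpace Ω] {P : Measure Ω} {ι κ : Type*} [Fintype ι]

theorem integrable_fun_mul {u w : Ω → ℝ} (hu : MemLp u 2 P) (hw : MemLp w 2 P) :
    Integrable (fun ω => u ω * w ω) P :=
  hu.integrable_mul hw

theorem memLp_mulVec {u : Ω → ι → ℝ} (hu : ∀ i, MemLp (fun ω => u ω i) 2 P)
    (M : Matrix κ ι ℝ) (k : κ) : MemLp (fun ω => (M *ᵥ u ω) k) 2 P := by
  simp only [Matrix.mulVec, dotProduct]
  exact memLp_finsetSum _ fun i _ => (hu i).const_mul _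

theorem integral_mulVec_mul {u : Ω → ι → ℝ} (hu : ∀ i, MemLp (fun ω => u ω i) 2 P)
    {w : Ω → ℝ} (hw : MemLp w 2 P) (M : Matrix κ ι ℝ) (k : κ) :
    ∫ ω, (M *ᵥ u ω) k * w ω ∂P = ∑ i, M k i * ∫ ω, u ω i * w ω ∂P := by
  simp only [Matrix.mulVec, dotProduct, Finset.sum_mul, mul_assoc]
  rw [integral_finsetSum _ fun i _ => (integrable_fun_mul (hu i) hw).const_mul _]
  simp only [integral_const_mul]

theorem integrable_dotProduct {u v : Ω → ι → ℝ} (hu : ∀ i, MemLp (fun ω => u ω i) 2 P)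
    (hv : ∀ i, MemLp (fun ω => v ω i) 2 P) : Integrable (fun ω => u ω ⬝ᵥ v ω) P :=
  integrable_finsetSum _ fun i _ => (hu i).integrable_mul (hv i)

theorem integral_dotProduct {u v : Ω → ι → ℝ} (hu : ∀ i, MemLp (fun ω => u ω i) 2 P)
    (hv : ∀ i, MemLp (fun ω => v ω i) 2 P) :
    ∫ ω, u ω ⬝ᵥ v ω ∂P = ∑ i, ∫ ω, u ω i * v ω i ∂P :=
  integral_finsetSum _ fun i _ => (hu i).integrable_mul (hv i)

/-- The normal equations of linear least squares are solvable. -/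
theorem exists_integral_sub_dotProduct_mul_eq_zero {u : Ω → ℝ} (hu : MemLp u 2 P)
    {y : Ω → ι → ℝ} (hy : ∀ i, MemLp (fun ω => y ω i) 2 P) :
    ∃ a : ι → ℝ, ∀ k, ∫ ω, (u ω - a ⬝ᵥ y ω) * y ω k ∂P = 0 := by
  let C : Matrix ι ι ℝ := Matrix.of fun i j => ∫ ω, y ω i * y ω j ∂P
  have hC : C.IsSymm := Matrix.IsSymm.ext fun i j => by simp [C, mul_comm]
  have hlin (v : ι → ℝ) : MemLp (fun ω => v ⬝ᵥ y ω) 2 P :=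
    memLp_mulVec hy (Matrix.of fun _ : Unit => v) ()
  have hint (v : ι → ℝ) {w : Ω → ℝ} (hw : MemLp w 2 P) :
      ∫ ω, (v ⬝ᵥ y ω) * w ω ∂P = ∑ i, v i * ∫ ω, y ω i * w ω ∂P :=
    integral_mulVec_mul hy hw (Matrix.of fun _ : Unit => v) ()
  have hCv (v : ι → ℝ) (k : ι) : (C *ᵥ v) k = ∫ ω, (v ⬝ᵥ y ω) * y ω k ∂P := by
    rw [hint v (hy k)]
    simp [Matrix.mulVec, dotProduct, C, mul_comm]
  -- The Gram matrix `C` may be singular: if `C v = 0`, then `E[(v ⬝ y)²] = 0`, so `v ⬝ y` vanishes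
  -- almost surely and is orthogonal to `u`.
  obtain ⟨a, ha⟩ := hC.exists_mulVec_eq (b := fun k => ∫ ω, u ω * y ω k ∂P) (by
    intro v hv
    have h0 : ∫ ω, (v ⬝ᵥ y ω) * (v ⬝ᵥ y ω) ∂P = 0 := by
      rw [hint v (hlin v)]
      refine Finset.sum_eq_zero fun k _ => ?_
      simp_rw [mul_comm (y _ k)]
      rw [← hCv, hv]
      simp
    have hae : (fun ω => v ⬝ᵥ y ω) =ᵐ[P] 0 := by
      rw [integral_eq_zero_iff_of_nonneg (fun ω => mul_self_nonneg _)
        ((hlin v).integrable_mul (hlin v))] at h0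
      filter_upwards [h0] with ω hω using mul_self_eq_zero.1 hω
    have : ∫ ω, (v ⬝ᵥ y ω) * u ω ∂P = 0 := by
      rw [integral_congr_ae (g := fun _ => (0 : ℝ))]
      · simp
      · filter_upwards [hae] with ω hω
        simp [hω]
    rw [hint v hu] at this
    rw [← this]
    simp [dotProduct, mul_comm])
  refine ⟨a, fun k => ?_⟩
  have := hCv a k
  rw [ha] at this
  simp only [sub_mul]
  rw [integral_sub (integrable_fun_mul hu (hy k)) (integrable_fun_mul (hlin a) (hy k)), ← this, sub_self]

end SecondOrder

/-! ### Conditional expectations of centred Gaussian vectors -/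

section Gaussian

variable {Ω : Type*} [MeasurableSpace Ω] {P : Measure Ω}
  {E : Type*} [NormedAddCommGroup E] [NormedSpace ℝ E] [FiniteDimensional ℝ E]
  [MeasurableSpace E] [BorelSpace E] {W : Ω → E} {ι κ : Type*} [Fintype ι] [Fintype κ]

theorem memLp_two_linearMap (hW : HasGaussianLaw W P) (T : E →ₗ[ℝ] ℝ) :
    MemLp (fun ω => T (W ω)) 2 P := by
  have : CompleteSpace E := FiniteDimensional.complete ℝ E
  exact (hW.map_fun T.toContinuousLinearMap).memLp_two

theorem integral_linearMap_eq_zero (hW : HasGaussianLaw W P) (h0 : ∫ ω, W ω ∂P = 0)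
    (T : E →ₗ[ℝ] ℝ) : ∫ ω, T (W ω) ∂P = 0 := by
  have : CompleteSpace E := FiniteDimensional.complete ℝ E
  have : ProperSpace E := FiniteDimensional.proper_real E
  have := T.toContinuousLinearMap.integral_comp_comm hW.integrable
  simpa [h0] using this

/-- Uncorrelated linear images of a centred Gaussian vector are independent. -/
theorem indepFun_linearMap_of_integral_mul_eq_zero (hW : HasGaussianLaw W P)
    (h0 : ∫ ω, W ω ∂P = 0) (T : E →ₗ[ℝ] ι → ℝ) (U : E →ₗ[ℝ] κ → ℝ)
    (h : ∀ i k, ∫ ω, T (W ω) i * U (W ω) k ∂P = 0) :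
    IndepFun (fun ω => T (W ω)) (fun ω => U (W ω)) P := by
  have := hW.isProbabilityMeasure
  refine HasGaussianLaw.indepFun_of_covariance_eval (X := fun i ω => T (W ω) i)
    (Y := fun k ω => U (W ω) k) (hW.map_fun (T.prod U).toContinuousLinearMap) fun i k => ?_
  refine (covariance_eq_sub (memLp_two_linearMap hW (LinearMap.proj i ∘ₗ T))
    (memLp_two_linearMap hW (LinearMap.proj k ∘ₗ U))).trans ?_
  rw [integral_linearMap_eq_zero hW h0 (LinearMap.proj i ∘ₗ T), zero_mul, sub_zero]
  exact h i k

/-- The conditional expectation of a linear image of a centred Gaussian vector given another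
linear image is the linear function of the latter with uncorrelated error. -/
theorem condExp_linearMap_ae_eq (hWm : Measurable W) (hW : HasGaussianLaw W P)
    (h0 : ∫ ω, W ω ∂P = 0) (T : E →ₗ[ℝ] ι → ℝ) (U : E →ₗ[ℝ] κ → ℝ) (A : Matrix ι κ ℝ)
    (h : ∀ i k, ∫ ω, (T (W ω) - A *ᵥ U (W ω)) i * U (W ω) k ∂P = 0) :
    condExp (MeasurableSpace.comap (fun ω => U (W ω)) inferInstance) P (fun ω => T (W ω))
      =ᵐ[P] fun ω => A *ᵥ U (W ω) := by
  have := hW.isProbabilityMeasure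
  have hUm : Measurable fun ω => U (W ω) :=
    U.continuous_of_finiteDimensional.measurable.comp hWm
  -- The error `R` is independent of `U`, so its conditional expectation is its mean, which is zero;
  -- the remaining part `A U` is measurable with respect to `U`.
  let R : E →ₗ[ℝ] ι → ℝ := T - A.mulVecLin ∘ₗ U
  have hRm : Measurable fun ω => R (W ω) :=
    R.continuous_of_finiteDimensional.measurable.comp hWm
  have hind := indepFun_linearMap_of_integral_mul_eq_zero hW h0 R U (by simpa [R] using h)
  have hR : condExp (MeasurableSpace.comap (fun ω => U (W ω)) inferInstance) P (fun ω => R (W ω))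
      =ᵐ[P] fun _ => ∫ ω, R (W ω) ∂P :=
    condExp_indep_eq hRm.comap_le hUm.comap_le (comap_measurable _).stronglyMeasurable
      ((IndepFun_iff_Indep _ _ _).1 hind)
  have hint {η : Type _} [Fintype η] (V : E →ₗ[ℝ] η → ℝ) : Integrable (fun ω => V (W ω)) P :=
    Integrable.of_eval fun i =>
      (memLp_two_linearMap hW (LinearMap.proj i ∘ₗ V)).integrable (by norm_num)
  have hRint : ∫ ω, R (W ω) ∂P = 0 := by
    ext i
    rw [eval_integral fun i => (hint R).eval i]
    exact integral_linearMap_eq_zero hW h0 (LinearMap.proj i ∘ₗ R)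
  have hsum : (fun ω => T (W ω)) =
      (fun ω => R (W ω)) + fun ω => (A.mulVecLin ∘ₗ U) (W ω) := by
    ext ω i
    simp [R]
  have hA : condExp (MeasurableSpace.comap (fun ω => U (W ω)) inferInstance) P
      (fun ω => (A.mulVecLin ∘ₗ U) (W ω)) = fun ω => (A.mulVecLin ∘ₗ U) (W ω) := by
    refine condExp_of_stronglyMeasurable hUm.comap_le ?_ (hint _)
    exact (A.mulVecLin.continuous_of_finiteDimensional.measurable.comp
      (comap_measurable _)).stronglyMeasurable
  rw [hsum]
  refine (condExp_add (hint R) (hint _) _).trans ?_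
  rw [hA]
  filter_upwards [hR] with ω hω
  simp [hω, hRint]

theorem exists_integral_sub_mulVec_mul_eq_zero (hW : HasGaussianLaw W P)
    {η : Type*} (T : E →ₗ[ℝ] η → ℝ) (U : E →ₗ[ℝ] κ → ℝ) :
    ∃ A : Matrix η κ ℝ, ∀ i k, ∫ ω, (T (W ω) - A *ᵥ U (W ω)) i * U (W ω) k ∂P = 0 := by
  choose A hA using fun i => exists_integral_sub_dotProduct_mul_eq_zero
    (memLp_two_linearMap hW (LinearMap.proj i ∘ₗ T))
    (fun k => memLp_two_linearMap hW (LinearMap.proj k ∘ₗ U))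
  exact ⟨Matrix.of A, hA⟩

end Gaussian

/-! ### Expected positive definite quadratic forms -/

/-- The matrix of second moments `E[u vᵀ]`. -/
noncomputable def secondMoment {Ω : Type*} [MeasurableSpace Ω] (P : Measure Ω) {ι κ : Type*}
    (u : Ω → ι → ℝ) (v : Ω → κ → ℝ) : Matrix ι κ ℝ :=
  Matrix.of fun a b => ∫ ω, u ω a * v ω b ∂P

/-- The stacked vector of the products `Fᵢ yᵢ`. -/
def gainVec {n : ℕ} {dy dz : Fin n → ℕ} (F : ∀ i, Matrix (Fin (dz i)) (Fin (dy i)) ℝ)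
    (y : ∀ i, Fin (dy i) → ℝ) : (Σ i, Fin (dz i)) → ℝ :=
  fun p => (F p.1 *ᵥ y p.1) p.2

section Quadratic

variable {Ω : Type*} [MeasurableSpace Ω] {P : Measure Ω} {ι κ : Type*} [Fintype ι] [Fintype κ]

theorem integral_mulVec_dotProduct_self {u : Ω → ι → ℝ} (hu : ∀ i, MemLp (fun ω => u ω i) 2 P)
    (M : Matrix ι ι ℝ) :
    ∫ ω, (M *ᵥ u ω) ⬝ᵥ u ω ∂P = (M * secondMoment P u u).trace := by
  rw [integral_dotProduct (memLp_mulVec hu M) hu]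
  simp only [integral_mulVec_mul hu (hu _), Matrix.trace, Matrix.diag, Matrix.mul_apply,
    secondMoment, Matrix.of_apply]

theorem posDef_eq_zero_of_mulVec_dotProduct {S : Matrix ι ι ℝ} (hS : S.PosDef) {w : ι → ℝ}
    (h : (S *ᵥ w) ⬝ᵥ w = 0) : w = 0 := by
  by_contra hw
  have := hS.dotProduct_mulVec_pos hw
  rw [dotProduct_comm] at h
  simp only [star_trivial] at this
  exact this.ne' h

theorem posDef_mulVec_dotProduct_nonneg {S : Matrix ι ι ℝ} (hS : S.PosDef) (w : ι → ℝ) :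
    0 ≤ (S *ᵥ w) ⬝ᵥ w := by
  rw [dotProduct_comm]
  simpa using hS.posSemidef.dotProduct_mulVec_nonneg w

theorem posDef_ae_eq_zero_of_integral {S : Matrix ι ι ℝ} (hS : S.PosDef) {w : Ω → ι → ℝ}
    (hw : ∀ i, MemLp (fun ω => w ω i) 2 P) (h : ∫ ω, (S *ᵥ w ω) ⬝ᵥ w ω ∂P = 0) :
    ∀ᵐ ω ∂P, w ω = 0 := by
  rw [integral_eq_zero_iff_of_nonneg (fun ω => posDef_mulVec_dotProduct_nonneg hS _)
    (integrable_dotProduct (memLp_mulVec hw S) hw)] at h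
  filter_upwards [h] with ω hω using posDef_eq_zero_of_mulVec_dotProduct hS hω

/-- A random vector with finite expected positive definite quadratic form is square integrable. -/
theorem memLp_two_of_lintegral_mulVec_dotProduct_ne_top {S : Matrix ι ι ℝ} (hS : S.PosDef)
    {w : Ω → ι → ℝ} (hw : ∀ i, AEStronglyMeasurable (fun ω => w ω i) P)
    (h : ∫⁻ ω, ENNReal.ofReal ((S *ᵥ w ω) ⬝ᵥ w ω) ∂P ≠ ∞) (i : ι) :
    MemLp (fun ω => w ω i) 2 P := by
  classical
  -- The form is `‖B w‖²`, so finiteness makes each coordinate of `B w` square integrable, and `w =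
  -- B⁻¹ (B w)`.
  obtain ⟨B, hB, hSB⟩ : ∃ B : Matrix ι ι ℝ, IsUnit B ∧ S = Bᵀ * B := by
    open scoped MatrixOrder in
    obtain ⟨B, hB, h⟩ := CStarAlgebra.isStrictlyPositive_iff_eq_star_mul_self.mp
      hS.isStrictlyPositive
    exact ⟨B, hB, by simpa [Matrix.star_eq_conjTranspose] using h⟩
  have hmeas (M : Matrix ι ι ℝ) (p : ι) :
      AEStronglyMeasurable (fun ω => (M *ᵥ w ω) p) P := by
    simp only [Matrix.mulVec, dotProduct]
    exact Finset.aestronglyMeasurable_fun_sum _ fun q _ => (hw q).const_mul _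
  have hq (ω : Ω) : (S *ᵥ w ω) ⬝ᵥ w ω = ∑ p, (B *ᵥ w ω) p ^ 2 := by
    rw [hSB, ← Matrix.mulVec_mulVec, Matrix.mulVec_transpose, ← Matrix.dotProduct_mulVec]
    simp [dotProduct, sq]
  have hint : Integrable (fun ω => (S *ᵥ w ω) ⬝ᵥ w ω) P := by
    refine ⟨?_, ?_⟩
    · exact Finset.aestronglyMeasurable_fun_sum _ fun q _ => (hmeas S q).mul (hw q)
    · rw [hasFiniteIntegral_iff_ofReal
        (Filter.Eventually.of_forall fun ω => posDef_mulVec_dotProduct_nonneg hS _)]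
      exact h.lt_top
  have hBw (p : ι) : MemLp (fun ω => (B *ᵥ w ω) p) 2 P := by
    rw [memLp_two_iff_integrable_sq (hmeas B p)]
    refine hint.mono' ((hmeas B p).pow 2) (Filter.Eventually.of_forall fun ω => ?_)
    rw [hq, Real.norm_of_nonneg (sq_nonneg _)]
    exact Finset.single_le_sum (f := fun p => (B *ᵥ w ω) p ^ 2) (fun q _ => sq_nonneg _)
      (Finset.mem_univ p)
  have := memLp_mulVec hBw B⁻¹ i
  simpa [Matrix.mulVec_mulVec, Matrix.nonsing_inv_mul _ ((Matrix.isUnit_iff_isUnit_det B).1 hB)]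
    using this

/-- Pythagoras' identity for an expected positive definite quadratic form, in `[0, ∞]`. -/
theorem lintegral_mulVec_dotProduct_sub {S : Matrix ι ι ℝ} (hS : S.PosDef) {r d : Ω → ι → ℝ}
    (hr : ∀ i, MemLp (fun ω => r ω i) 2 P) (hd : ∀ i, AEStronglyMeasurable (fun ω => d ω i) P)
    (horth : (∀ i, MemLp (fun ω => d ω i) 2 P) → ∀ i, ∫ ω, (S *ᵥ r ω) i * d ω i ∂P = 0) :
    ∫⁻ ω, ENNReal.ofReal ((S *ᵥ (r ω - d ω)) ⬝ᵥ (r ω - d ω)) ∂P =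
      ENNReal.ofReal (∫ ω, (S *ᵥ r ω) ⬝ᵥ r ω ∂P)
        + ∫⁻ ω, ENNReal.ofReal ((S *ᵥ d ω) ⬝ᵥ d ω) ∂P := by
  have hnn := posDef_mulVec_dotProduct_nonneg hS
  -- If `d` is not square integrable, neither is `r - d`, since `r` is; both sides are then
  -- infinite.
  by_cases hd2 : ∀ i, MemLp (fun ω => d ω i) 2 P
  · have hrd : ∀ i, MemLp (fun ω => (r ω - d ω) i) 2 P := fun i => (hr i).sub (hd2 i)
    rw [← ofReal_integral_eq_lintegral_ofReal (integrable_dotProduct (memLp_mulVec hrd S) hrd)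
        (Filter.Eventually.of_forall fun ω => hnn _),
      ← ofReal_integral_eq_lintegral_ofReal (integrable_dotProduct (memLp_mulVec hd2 S) hd2)
        (Filter.Eventually.of_forall fun ω => hnn _),
      ← ENNReal.ofReal_add (integral_nonneg fun ω => hnn _) (integral_nonneg fun ω => hnn _)]
    congr 1
    have hrr := integrable_dotProduct (memLp_mulVec hr S) hr
    have hdd := integrable_dotProduct (memLp_mulVec hd2 S) hd2
    have hx := integrable_dotProduct (memLp_mulVec hr S) hd2
    have hx0 : ∫ ω, (S *ᵥ r ω) ⬝ᵥ d ω ∂P = 0 := by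
      rw [integral_dotProduct (memLp_mulVec hr S) hd2]
      exact Finset.sum_eq_zero fun i _ => horth hd2 i
    have hexp (ω : Ω) : (S *ᵥ (r ω - d ω)) ⬝ᵥ (r ω - d ω) =
        (S *ᵥ r ω) ⬝ᵥ r ω + (S *ᵥ d ω) ⬝ᵥ d ω - 2 * ((S *ᵥ r ω) ⬝ᵥ d ω) := by
      have hsymm : (S *ᵥ d ω) ⬝ᵥ r ω = (S *ᵥ r ω) ⬝ᵥ d ω := by
        rw [dotProduct_comm, Matrix.dotProduct_mulVec, ← Matrix.mulVec_transpose,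
          ← Matrix.conjTranspose_eq_transpose_of_trivial, hS.isHermitian.eq]
      rw [Matrix.mulVec_sub, sub_dotProduct, dotProduct_sub, dotProduct_sub, hsymm]
      ring
    simp only [hexp]
    rw [integral_sub (hrr.fun_add hdd) (hx.const_mul 2), integral_add hrr hdd, integral_const_mul,
      hx0]
    ring
  · have hdtop : ∫⁻ ω, ENNReal.ofReal ((S *ᵥ d ω) ⬝ᵥ d ω) ∂P = ∞ := by
      by_contra h
      exact hd2 (memLp_two_of_lintegral_mulVec_dotProduct_ne_top hS hd h)
    rw [hdtop, add_top]
    by_contra h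
    refine hd2 fun i => ?_
    have := memLp_two_of_lintegral_mulVec_dotProduct_ne_top hS
      (w := fun ω => r ω - d ω) (fun i => (hr i).aestronglyMeasurable.sub (hd i)) h i
    have heq : (fun ω => d ω i) = (fun ω => r ω i) - fun ω => (r ω - d ω) i := by
      ext ω
      simp
    rw [heq]
    exact (hr i).sub this

end Quadratic

/-! ### The gain equations as a Gram system -/

section Gains

variable {Ω : Type*} [MeasurableSpace Ω] {P : Measure Ω} {n dx d0 : ℕ} {dy dz : Fin n → ℕ}
  {S : Matrix (Σ i, Fin (dz i)) (Σ i, Fin (dz i)) ℝ} {L : Matrix (Σ i, Fin (dz i)) (Fin dx) ℝ}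
  {x X : Ω → Fin dx → ℝ} {y0 : Ω → Fin d0 → ℝ} {y Y : ∀ i, Ω → Fin (dy i) → ℝ}

theorem memLp_gainVec (hY : ∀ i b, MemLp (fun ω => Y i ω b) 2 P)
    (F : ∀ i, Matrix (Fin (dz i)) (Fin (dy i)) ℝ) (p : Σ i, Fin (dz i)) :
    MemLp (fun ω => gainVec F (fun i => Y i ω) p) 2 P :=
  memLp_mulVec (hY p.1) (F p.1) p.2

theorem integral_dotProduct_gainVec (hY : ∀ i b, MemLp (fun ω => Y i ω b) 2 P)
    {w : Ω → (Σ i, Fin (dz i)) → ℝ} (hw : ∀ p, MemLp (fun ω => w ω p) 2 P)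
    (F : ∀ i, Matrix (Fin (dz i)) (Fin (dy i)) ℝ) :
    ∫ ω, w ω ⬝ᵥ gainVec F (fun i => Y i ω) ∂P =
      (fun q : Σ i, Fin (dy i) × Fin (dz i) => ∫ ω, w ω ⟨q.1, q.2.2⟩ * Y q.1 ω q.2.1 ∂P)
        ⬝ᵥ stackVec F := by
  rw [integral_dotProduct hw (memLp_gainVec hY F)]
  simp only [dotProduct, Fintype.sum_sigma, Fintype.sum_prod_type]
  refine Finset.sum_congr rfl fun i _ => ?_
  rw [Finset.sum_comm]
  refine Finset.sum_congr rfl fun a _ => ?_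
  simp_rw [mul_comm (w _ _)]
  refine (integral_mulVec_mul (hY i) (hw ⟨i, a⟩) (F i) a).trans ?_
  simp [stackVec, Matrix.vec, mul_comm]

/-- This turns `Γ` into a correlation operator: it sends gains to the correlation of each block of
`S (F Y)` with that agent's own innovation. Its quadratic form is therefore `E[(F Y)ᵀ S (F Y)]`. -/
theorem Gam_mulVec_stackVec (hY : ∀ i b, MemLp (fun ω => Y i ω b) 2 P)
    (hSig : ∀ i j, SigmaHat P y0 y i j = secondMoment P (Y i) (Y j))
    (F : ∀ i, Matrix (Fin (dz i)) (Fin (dy i)) ℝ) (q : Σ i, Fin (dy i) × Fin (dz i)) :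
    (Gam P S y0 y *ᵥ stackVec F) q =
      ∫ ω, (S *ᵥ gainVec F fun i => Y i ω) ⟨q.1, q.2.2⟩ * Y q.1 ω q.2.1 ∂P := by
  obtain ⟨i, b, a⟩ := q
  rw [integral_mulVec_mul (memLp_gainVec hY F) (hY i b)]
  simp only [Matrix.mulVec, dotProduct, Fintype.sum_sigma, Fintype.sum_prod_type]
  refine Finset.sum_congr rfl fun j _ => ?_
  rw [Finset.sum_comm]
  refine Finset.sum_congr rfl fun c _ => ?_
  refine Eq.trans ?_ (congrArg _ (integral_mulVec_mul (hY j) (hY i b) (F j) c).symm)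
  rw [Finset.mul_sum]
  refine Finset.sum_congr rfl fun e _ => ?_
  simp only [Gam, hSig, secondMoment, block, stackVec, Matrix.vec, Matrix.of_apply,
    Matrix.kroneckerMap_apply, mul_comm (Y i _ b)]
  ring

theorem eta_apply (hX : ∀ e, MemLp (fun ω => X ω e) 2 P)
    (hY : ∀ i b, MemLp (fun ω => Y i ω b) 2 P)
    (hTheta : ∀ i, ThetaHat P x y0 y i = secondMoment P X (Y i))
    (q : Σ i, Fin (dy i) × Fin (dz i)) :
    eta P S L x y0 y q = ∫ ω, (S *ᵥ (L *ᵥ X ω)) ⟨q.1, q.2.2⟩ * Y q.1 ω q.2.1 ∂P := by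
  obtain ⟨i, b, a⟩ := q
  simp only [Matrix.mulVec_mulVec]
  rw [integral_mulVec_mul hX (hY i b)]
  simp only [eta, stackVec, Matrix.vec, hTheta, Matrix.mul_apply, secondMoment, rowBlock,
    Matrix.of_apply]

/-- The identity `vec(S F Σ) = (Σᵀ ⊗ S) vec F`, applied blockwise. The equations contain `Σ̂ⱼᵢ` and
`Γ` contains `Σ̂ᵢⱼ`, its transpose. -/
theorem solvesGainEq_iff (hSig : ∀ i j, SigmaHat P y0 y i j = secondMoment P (Y i) (Y j))
    (F : ∀ i, Matrix (Fin (dz i)) (Fin (dy i)) ℝ) :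
    SolvesGainEq P S L x y0 y F ↔ Gam P S y0 y *ᵥ stackVec F = eta P S L x y0 y := by
  have key (i : Fin n) (a : Fin (dz i)) (b : Fin (dy i)) :
      (∑ j, (block S i j * F j * SigmaHat P y0 y j i
        - block S i j * rowBlock L j * ThetaHat P x y0 y i)) a b =
      (Gam P S y0 y *ᵥ stackVec F) ⟨i, b, a⟩ - eta P S L x y0 y ⟨i, b, a⟩ := by
    rw [Finset.sum_sub_distrib, Matrix.sub_apply]
    congr 1
    · simp only [Matrix.sum_apply, Matrix.mul_apply, Matrix.mulVec, dotProduct,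
        Fintype.sum_sigma, Fintype.sum_prod_type, Finset.sum_mul]
      refine Finset.sum_congr rfl fun j _ => Finset.sum_congr rfl fun e _ =>
        Finset.sum_congr rfl fun c _ => ?_
      simp only [Gam, hSig, secondMoment, block, stackVec, Matrix.vec, Matrix.of_apply,
        Matrix.kroneckerMap_apply, mul_comm (Y i _ b)]
      ring
    · rw [← Matrix.sum_mul]
      have hSL : ∑ j, block S i j * rowBlock L j = rowBlock S i * L := by
        ext a' e
        simp only [Matrix.sum_apply, Matrix.mul_apply, block, rowBlock, Matrix.of_apply,
          Fintype.sum_sigma]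
      rw [hSL]
      rfl
  constructor
  · intro h
    ext ⟨i, b, a⟩
    rw [← sub_eq_zero, ← key, h i, Matrix.zero_apply]
  · intro h i
    ext a b
    rw [key, h, sub_self, Matrix.zero_apply]

theorem Gam_isSymm (hS : S.PosDef)
    (hSig : ∀ i j, SigmaHat P y0 y i j = secondMoment P (Y i) (Y j)) :
    (Gam P S y0 y).IsSymm := by
  refine Matrix.IsSymm.ext fun p q => ?_
  have := hS.isHermitian.apply ⟨p.1, p.2.2⟩ ⟨q.1, q.2.2⟩
  simp only [star_trivial] at this
  simp only [Gam, hSig, secondMoment, block, Matrix.of_apply, Matrix.kroneckerMap_apply, this]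
  simp only [mul_comm (Y p.1 _ _)]

theorem stackVec_bijective : Function.Bijective
    (stackVec : (∀ i, Matrix (Fin (dz i)) (Fin (dy i)) ℝ) → _) := by
  refine ⟨fun F G h => ?_, fun v => ⟨fun i => Matrix.of fun a b => v ⟨i, b, a⟩, rfl⟩⟩
  ext i a b
  exact congrFun h ⟨i, b, a⟩

/-- On the kernel of `Γ` the expectation `E[(F Y)ᵀ S (F Y)]` vanishes, and `S` is positive definite.
-/
theorem gainVec_ae_eq_zero_of_Gam_mulVec (hS : S.PosDef)
    (hY : ∀ i b, MemLp (fun ω => Y i ω b) 2 P)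
    (hSig : ∀ i j, SigmaHat P y0 y i j = secondMoment P (Y i) (Y j))
    {F : ∀ i, Matrix (Fin (dz i)) (Fin (dy i)) ℝ} (hF : Gam P S y0 y *ᵥ stackVec F = 0) :
    ∀ᵐ ω ∂P, gainVec F (fun i => Y i ω) = 0 := by
  refine posDef_ae_eq_zero_of_integral hS (memLp_gainVec hY F) ?_
  rw [integral_dotProduct_gainVec hY (memLp_mulVec (memLp_gainVec hY F) S)]
  simp only [← Gam_mulVec_stackVec hY hSig, hF]
  simp [dotProduct]

theorem eta_dotProduct_stackVec (hX : ∀ e, MemLp (fun ω => X ω e) 2 P)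
    (hY : ∀ i b, MemLp (fun ω => Y i ω b) 2 P)
    (hTheta : ∀ i, ThetaHat P x y0 y i = secondMoment P X (Y i))
    (F : ∀ i, Matrix (Fin (dz i)) (Fin (dy i)) ℝ) :
    eta P S L x y0 y ⬝ᵥ stackVec F =
      ∫ ω, (S *ᵥ (L *ᵥ X ω)) ⬝ᵥ gainVec F (fun i => Y i ω) ∂P := by
  rw [integral_dotProduct_gainVec hY (memLp_mulVec (memLp_mulVec hX L) S)]
  simp only [← eta_apply hX hY hTheta]

/-- A kernel vector of the symmetric matrix `Γ` has `F Y = 0` almost surely, so it is orthogonal to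
`η`; no nondegeneracy of the innovations is needed. -/
theorem exists_solvesGainEq (hS : S.PosDef) (hX : ∀ e, MemLp (fun ω => X ω e) 2 P)
    (hY : ∀ i b, MemLp (fun ω => Y i ω b) 2 P)
    (hSig : ∀ i j, SigmaHat P y0 y i j = secondMoment P (Y i) (Y j))
    (hTheta : ∀ i, ThetaHat P x y0 y i = secondMoment P X (Y i)) :
    ∃ F, SolvesGainEq P S L x y0 y F := by
  obtain ⟨v, hv⟩ := (Gam_isSymm hS hSig).exists_mulVec_eq (b := eta P S L x y0 y) (by
    intro v hv
    obtain ⟨F, rfl⟩ := stackVec_bijective.2 v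
    rw [eta_dotProduct_stackVec hX hY hTheta, integral_congr_ae (g := fun _ => (0 : ℝ))]
    · simp
    · filter_upwards [gainVec_ae_eq_zero_of_Gam_mulVec hS hY hSig hv] with ω hω
      rw [hω, dotProduct_zero])
  obtain ⟨F, rfl⟩ := stackVec_bijective.2 v
  exact ⟨F, (solvesGainEq_iff hSig F).2 hv⟩

theorem isUnit_Gam (hS : S.PosDef) (hY : ∀ i b, MemLp (fun ω => Y i ω b) 2 P)
    (hSig : ∀ i j, SigmaHat P y0 y i j = secondMoment P (Y i) (Y j))
    (hpos : ∀ i, (SigmaHat P y0 y i i).PosDef) : IsUnit (Gam P S y0 y) := by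
  rw [← Matrix.mulVec_injective_iff_isUnit, ← Matrix.coe_mulVecLin, ← LinearMap.ker_eq_bot,
    LinearMap.ker_eq_bot']
  intro v hv
  obtain ⟨F, rfl⟩ := stackVec_bijective.2 v
  have h0 := gainVec_ae_eq_zero_of_Gam_mulVec hS hY hSig hv
  have hF (i : Fin n) : F i = 0 := by
    -- `Fᵢ Σ̂ᵢᵢ = E[(Fᵢ Yᵢ) Yᵢᵀ]`, and `Fᵢ Yᵢ` vanishes almost surely; only the diagonal blocks need
    -- to be invertible.
    have hmul : F i * SigmaHat P y0 y i i = 0 := by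
      ext a b
      rw [Matrix.mul_apply, hSig]
      refine (integral_mulVec_mul (hY i) (hY i b) (F i) a).symm.trans ?_
      rw [integral_congr_ae (g := fun _ => (0 : ℝ))]
      · simp
      · filter_upwards [h0] with ω hω
        have : (F i *ᵥ Y i ω) a = 0 := congrFun hω ⟨i, a⟩
        rw [this, zero_mul]
    have hu := (Matrix.isUnit_iff_isUnit_det _).1 (hpos i).isUnit
    rw [← Matrix.mul_nonsing_inv_cancel_right _ (F i) hu, hmul, Matrix.zero_mul]
  ext ⟨i, b, a⟩
  simp [stackVec, Matrix.vec, hF]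

/-- The residual weighted by `S` is uncorrelated with the innovations. -/
theorem SolvesGainEq.integral_residual_mul (hX : ∀ e, MemLp (fun ω => X ω e) 2 P)
    (hY : ∀ i b, MemLp (fun ω => Y i ω b) 2 P)
    (hSig : ∀ i j, SigmaHat P y0 y i j = secondMoment P (Y i) (Y j))
    (hTheta : ∀ i, ThetaHat P x y0 y i = secondMoment P X (Y i))
    {F : ∀ i, Matrix (Fin (dz i)) (Fin (dy i)) ℝ} (hF : SolvesGainEq P S L x y0 y F)
    (i : Fin n) (a : Fin (dz i)) (b : Fin (dy i)) :
    ∫ ω, (S *ᵥ (L *ᵥ X ω - gainVec F fun i => Y i ω)) ⟨i, a⟩ * Y i ω b ∂P = 0 := by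
  have h := congrFun ((solvesGainEq_iff hSig F).1 hF) ⟨i, b, a⟩
  rw [Gam_mulVec_stackVec hY hSig, eta_apply hX hY hTheta] at h
  simp only [Matrix.mulVec_sub, Pi.sub_apply, sub_mul]
  rw [integral_sub (integrable_fun_mul (memLp_mulVec (memLp_mulVec hX L) S _) (hY i b))
    (integrable_fun_mul (memLp_mulVec (memLp_gainVec hY F) S _) (hY i b)), h, sub_self]

/-- Orthogonality of `S r` to `F Y` leaves `E[(S r) ⬝ L X]`. Its `L X` part is the trace and, by
symmetry of `S`, its `F Y` part is `η ⬝ vec F`. -/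
theorem SolvesGainEq.integral_residual (hX : ∀ e, MemLp (fun ω => X ω e) 2 P)
    (hY : ∀ i b, MemLp (fun ω => Y i ω b) 2 P) (hS : S.PosDef)
    (hSig : ∀ i j, SigmaHat P y0 y i j = secondMoment P (Y i) (Y j))
    (hTheta : ∀ i, ThetaHat P x y0 y i = secondMoment P X (Y i))
    {F : ∀ i, Matrix (Fin (dz i)) (Fin (dy i)) ℝ} (hF : SolvesGainEq P S L x y0 y F) :
    ∫ ω, (S *ᵥ (L *ᵥ X ω - gainVec F fun i => Y i ω)) ⬝ᵥ
        (L *ᵥ X ω - gainVec F fun i => Y i ω) ∂P =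
      (Lᵀ * S * L * secondMoment P X X).trace - eta P S L x y0 y ⬝ᵥ stackVec F := by
  have hLX := memLp_mulVec hX L
  have hr : ∀ p, MemLp (fun ω => (L *ᵥ X ω - gainVec F fun i => Y i ω) p) 2 P :=
    fun p => (hLX p).sub (memLp_gainVec hY F p)
  have h1 : ∫ ω, (S *ᵥ (L *ᵥ X ω - gainVec F fun i => Y i ω)) ⬝ᵥ
      (gainVec F fun i => Y i ω) ∂P = 0 := by
    rw [integral_dotProduct_gainVec hY (memLp_mulVec hr S)]
    simp only [hF.integral_residual_mul hX hY hSig hTheta]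
    simp [dotProduct]
  have h2 : ∫ ω, (S *ᵥ (gainVec F fun i => Y i ω)) ⬝ᵥ (L *ᵥ X ω) ∂P =
      ∫ ω, (S *ᵥ (L *ᵥ X ω)) ⬝ᵥ (gainVec F fun i => Y i ω) ∂P := by
    congr 1
    ext ω
    rw [dotProduct_comm, Matrix.dotProduct_mulVec, ← Matrix.mulVec_transpose,
      ← Matrix.conjTranspose_eq_transpose_of_trivial, hS.isHermitian.eq]
  have h3 (ω : Ω) : (S *ᵥ (L *ᵥ X ω)) ⬝ᵥ (L *ᵥ X ω) = ((Lᵀ * S * L) *ᵥ X ω) ⬝ᵥ X ω := by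
    rw [Matrix.mul_assoc, ← Matrix.mulVec_mulVec, Matrix.mulVec_transpose,
      ← Matrix.dotProduct_mulVec, Matrix.mulVec_mulVec]
  have h4 (ω : Ω) : (S *ᵥ (L *ᵥ X ω - gainVec F fun i => Y i ω)) ⬝ᵥ
        (L *ᵥ X ω - gainVec F fun i => Y i ω) =
      (S *ᵥ (L *ᵥ X ω)) ⬝ᵥ (L *ᵥ X ω) - (S *ᵥ (gainVec F fun i => Y i ω)) ⬝ᵥ (L *ᵥ X ω)
        - (S *ᵥ (L *ᵥ X ω - gainVec F fun i => Y i ω)) ⬝ᵥ (gainVec F fun i => Y i ω) := by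
    rw [dotProduct_sub, Matrix.mulVec_sub, sub_dotProduct]
  simp only [h4]
  have i1 := integrable_dotProduct (memLp_mulVec hLX S) hLX
  have i2 := integrable_dotProduct (memLp_mulVec (memLp_gainVec hY F) S) hLX
  rw [integral_sub (i1.sub' i2)
      (integrable_dotProduct (memLp_mulVec hr S) (memLp_gainVec hY F)), h1,
    integral_sub i1 i2, h2, ← eta_dotProduct_stackVec hX hY hTheta]
  simp only [h3, integral_mulVec_dotProduct_self hX, sub_zero]

end Gains

/-! ### Innovations, deviations and the cost decomposition -/

section Innovations

variable {Ω : Type*} [MeasurableSpace Ω] {P : Measure Ω} {n dx d0 : ℕ} {dy dz : Fin n → ℕ}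

theorem crossCov_eq_secondMoment [IsProbabilityMeasure P] {k l : ℕ} {u u' : Ω → Fin k → ℝ}
    {v v' : Ω → Fin l → ℝ} (hu : u =ᵐ[P] u') (hv : v =ᵐ[P] v')
    (hu2 : ∀ a, MemLp (fun ω => u' ω a) 2 P) (hv2 : ∀ b, MemLp (fun ω => v' ω b) 2 P)
    (hu0 : ∀ a, ∫ ω, u' ω a ∂P = 0) : crossCov P u v = secondMoment P u' v' := by
  ext a b
  have hua : (fun ω => u ω a) =ᵐ[P] fun ω => u' ω a := by
    filter_upwards [hu] with ω hω using congrFun hω a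
  have hvb : (fun ω => v ω b) =ᵐ[P] fun ω => v' ω b := by
    filter_upwards [hv] with ω hω using congrFun hω b
  have hcov : covariance (fun ω => u ω a) (fun ω => v ω b) P =
      covariance (fun ω => u' ω a) (fun ω => v' ω b) P := by
    unfold covariance
    rw [integral_congr_ae hua, integral_congr_ae hvb]
    refine integral_congr_ae ?_
    filter_upwards [hua, hvb] with ω h1 h2
    rw [h1, h2]
  rw [crossCov, Matrix.of_apply, hcov, covariance_eq_sub (hu2 a) (hv2 b), hu0, zero_mul, sub_zero]
  rfl

theorem innovation_ae_eq_sub_mulVec {k : ℕ} {y0 : Ω → Fin d0 → ℝ} {u : Ω → Fin k → ℝ}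
    {A : Matrix (Fin k) (Fin d0) ℝ} (h : commonEst P y0 u =ᵐ[P] fun ω => A *ᵥ y0 ω) :
    innovation P y0 u =ᵐ[P] fun ω => u ω - A *ᵥ y0 ω := by
  filter_upwards [h] with ω hω
  simp [innovation, hω]

variable {x : Ω → Fin dx → ℝ} {y0 : Ω → Fin d0 → ℝ} {y : ∀ i, Ω → Fin (dy i) → ℝ}
  {S : Matrix (Σ i, Fin (dz i)) (Σ i, Fin (dz i)) ℝ} {L : Matrix (Σ i, Fin (dz i)) (Fin dx) ℝ}

theorem integral_measurements_eq_zero [IsProbabilityMeasure P]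
    (hgauss : HasGaussianLaw (fun ω => (x ω, y0 ω, fun i => y i ω)) P)
    (hx_mean : ∫ ω, x ω ∂P = 0) (hy0_mean : ∫ ω, y0 ω ∂P = 0)
    (hy_mean : ∀ i, ∫ ω, y i ω ∂P = 0) :
    ∫ ω, (x ω, y0 ω, fun i => y i ω) ∂P = 0 := by
  have hint := hgauss.integrable
  rw [integral_pair hint.fst hint.snd, integral_pair hint.snd.fst hint.snd.snd, hx_mean, hy0_mean]
  refine Prod.ext rfl (Prod.ext rfl ?_)
  funext i
  exact (eval_integral (fun i => hint.snd.snd.eval i) i).trans (hy_mean i)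

/-- The residual `L (x - A₀ y₀) - vec(Fᵢ (yᵢ - Aᵢ y₀))`, weighted by `S`, as a linear map. -/
def weightedResidual (S : Matrix (Σ i, Fin (dz i)) (Σ i, Fin (dz i)) ℝ)
    (L : Matrix (Σ i, Fin (dz i)) (Fin dx) ℝ) (A0 : Matrix (Fin dx) (Fin d0) ℝ)
    (A : ∀ i, Matrix (Fin (dy i)) (Fin d0) ℝ) (F : ∀ i, Matrix (Fin (dz i)) (Fin (dy i)) ℝ) :
    ((Fin dx → ℝ) × (Fin d0 → ℝ) × (∀ i, Fin (dy i) → ℝ)) →ₗ[ℝ] ((Σ i, Fin (dz i)) → ℝ) where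
  toFun e := S *ᵥ (L *ᵥ (e.1 - A0 *ᵥ e.2.1) - gainVec F fun i => e.2.2 i - A i *ᵥ e.2.1)
  map_add' e f := by
    rw [← Matrix.mulVec_add]
    congr 1
    ext p
    simp only [gainVec, Prod.fst_add, Prod.snd_add, Pi.add_apply, Pi.sub_apply,
      Matrix.mulVec_add, Matrix.mulVec_sub]
    ring
  map_smul' c e := by
    rw [RingHom.id_apply, ← Matrix.mulVec_smul]
    congr 1
    ext p
    simp only [gainVec, Prod.smul_fst, Prod.smul_snd, Pi.smul_apply, Pi.sub_apply,
      Matrix.mulVec_smul, Matrix.mulVec_sub, smul_eq_mul]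
    ring

/-- The measurement `y₀` together with `yᵢ - Aᵢ y₀`, as a linear map. -/
def localData (A : ∀ i, Matrix (Fin (dy i)) (Fin d0) ℝ) (i : Fin n) :
    ((Fin dx → ℝ) × (Fin d0 → ℝ) × (∀ i, Fin (dy i) → ℝ)) →ₗ[ℝ]
      (Fin d0 ⊕ Fin (dy i) → ℝ) where
  toFun e := Sum.elim e.2.1 (e.2.2 i - A i *ᵥ e.2.1)
  map_add' e f := by
    ext (k | b)
    · simp
    · simp only [Prod.snd_add, Prod.fst_add, Pi.add_apply, Sum.elim_inr, Pi.sub_apply,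
        Matrix.mulVec_add]
      ring
  map_smul' c e := by
    ext (k | b)
    · simp
    · simp only [Prod.smul_snd, Prod.smul_fst, Pi.smul_apply, Sum.elim_inr, Pi.sub_apply,
        Matrix.mulVec_smul, RingHom.id_apply, smul_eq_mul]
      ring

/-- If the weighted residual of agent `i` is uncorrelated with `y₀` and the innovation of the
agent, then it is orthogonal to every function of the measurements of the agent. -/
theorem integral_weightedResidual_mul_eq_zero [IsProbabilityMeasure P]
    (hx : Measurable x) (hy0 : Measurable y0) (hy : ∀ i, Measurable (y i))
    (hgauss : HasGaussianLaw (fun ω => (x ω, y0 ω, fun i => y i ω)) P)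
    (hmean : ∫ ω, (x ω, y0 ω, fun i => y i ω) ∂P = 0)
    {A0 : Matrix (Fin dx) (Fin d0) ℝ} {A : ∀ i, Matrix (Fin (dy i)) (Fin d0) ℝ}
    {F : ∀ i, Matrix (Fin (dz i)) (Fin (dy i)) ℝ} {i : Fin n} {a : Fin (dz i)}
    (h0 : ∀ k, ∫ ω, (S *ᵥ (L *ᵥ (x ω - A0 *ᵥ y0 ω) -
      gainVec F fun i => y i ω - A i *ᵥ y0 ω)) ⟨i, a⟩ * y0 ω k ∂P = 0)
    (h1 : ∀ b, ∫ ω, (S *ᵥ (L *ᵥ (x ω - A0 *ᵥ y0 ω) -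
      gainVec F fun i => y i ω - A i *ᵥ y0 ω)) ⟨i, a⟩ * (y i ω - A i *ᵥ y0 ω) b ∂P = 0)
    {φ : (Fin d0 → ℝ) × (Fin (dy i) → ℝ) → ℝ} (hφ : Measurable φ) :
    ∫ ω, (S *ᵥ (L *ᵥ (x ω - A0 *ᵥ y0 ω) -
      gainVec F fun i => y i ω - A i *ᵥ y0 ω)) ⟨i, a⟩ * φ (y0 ω, y i ω) ∂P = 0 := by
  -- A single coordinate is taken: the other blocks of the weighted residual may be correlated with
  -- the data of agent `i`.
  let R : ((Fin dx → ℝ) × (Fin d0 → ℝ) × (∀ i, Fin (dy i) → ℝ)) →ₗ[ℝ] (Unit → ℝ) :=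
    LinearMap.pi fun _ => LinearMap.proj (⟨i, a⟩ : Σ i, Fin (dz i)) ∘ₗ weightedResidual S L A0 A F
  have hW : Measurable fun ω => (x ω, y0 ω, fun i => y i ω) :=
    hx.prodMk (hy0.prodMk (measurable_pi_lambda _ hy))
  have hind := indepFun_linearMap_of_integral_mul_eq_zero hgauss hmean R (localData A i) (by
    rintro _ (k | b)
    · exact h0 k
    · exact h1 b)
  -- `ψ` recovers `yᵢ` from `y₀` and `yᵢ - Aᵢ y₀` before applying `φ`.
  let ψ : (Fin d0 ⊕ Fin (dy i) → ℝ) → ℝ := fun v =>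
    φ (fun k => v (Sum.inl k), (fun b => v (Sum.inr b)) + A i *ᵥ fun k => v (Sum.inl k))
  have hψ : Measurable ψ := by
    refine hφ.comp (Measurable.prodMk (by fun_prop) (Measurable.add (by fun_prop) ?_))
    exact (A i).mulVecLin.continuous_of_finiteDimensional.measurable.comp (by fun_prop)
  have hRm : Measurable fun ω => R (x ω, y0 ω, fun i => y i ω) :=
    R.continuous_of_finiteDimensional.measurable.comp hW
  have hUm : Measurable fun ω => localData A i (x ω, y0 ω, fun i => y i ω) :=
    (localData A i).continuous_of_finiteDimensional.measurable.comp hW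
  -- The product rule for independent factors needs only measurability here, so `φ` need not be
  -- integrable.
  have hprod := (hind.comp (measurable_pi_apply ()) hψ).integral_fun_mul_eq_mul_integral
    ((measurable_pi_apply ()).comp hRm).aestronglyMeasurable
    (hψ.comp hUm).aestronglyMeasurable
  have hR0 : ∫ ω, ((fun v : Unit → ℝ => v ()) ∘ fun ω => R (x ω, y0 ω, fun i => y i ω)) ω ∂P = 0 :=
    integral_linearMap_eq_zero hgauss hmean (LinearMap.proj () ∘ₗ R)
  rw [hR0, zero_mul] at hprod
  rw [← hprod]
  refine integral_congr_ae (Filter.Eventually.of_forall fun ω => ?_)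
  have hψω : ψ (localData A i (x ω, y0 ω, fun i => y i ω)) = φ (y0 ω, y i ω) := by
    change φ (y0 ω, (y i ω - A i *ᵥ y0 ω) + A i *ᵥ y0 ω) = _
    rw [sub_add_cancel]
  simp only [Function.comp_apply, hψω]
  rfl

/-- The deviation of the estimates of a strategy from `Lᵢ A₀ y₀ + Fᵢ (yᵢ - Aᵢ y₀)`. -/
def deviation (L : Matrix (Σ i, Fin (dz i)) (Fin dx) ℝ) (A0 : Matrix (Fin dx) (Fin d0) ℝ)
    (A : ∀ i, Matrix (Fin (dy i)) (Fin d0) ℝ) (F : ∀ i, Matrix (Fin (dz i)) (Fin (dy i)) ℝ)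
    (g : Strategy d0 dy dz) (u : Fin d0 → ℝ) (v : ∀ i, Fin (dy i) → ℝ) :
    (Σ i, Fin (dz i)) → ℝ :=
  fun p => (g.rule p.1 u (v p.1) -
    (rowBlock L p.1 *ᵥ (A0 *ᵥ u) + F p.1 *ᵥ (v p.1 - A p.1 *ᵥ u))) p.2

/-- Each deviation is a measurable function of the measurements of the agent. -/
theorem measurable_deviation_apply (L : Matrix (Σ i, Fin (dz i)) (Fin dx) ℝ)
    (A0 : Matrix (Fin dx) (Fin d0) ℝ) (A : ∀ i, Matrix (Fin (dy i)) (Fin d0) ℝ)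
    (F : ∀ i, Matrix (Fin (dz i)) (Fin (dy i)) ℝ) (g : Strategy d0 dy dz)
    (p : Σ i, Fin (dz i)) :
    Measurable fun q : (Fin d0 → ℝ) × (Fin (dy p.1) → ℝ) =>
      (g.rule p.1 q.1 q.2 -
        (rowBlock L p.1 *ᵥ (A0 *ᵥ q.1) + F p.1 *ᵥ (q.2 - A p.1 *ᵥ q.1))) p.2 := by
  have hlin : Measurable fun q : (Fin d0 → ℝ) × (Fin (dy p.1) → ℝ) =>
      rowBlock L p.1 *ᵥ (A0 *ᵥ q.1) + F p.1 *ᵥ (q.2 - A p.1 *ᵥ q.1) :=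
    ((rowBlock L p.1).mulVecLin ∘ₗ A0.mulVecLin ∘ₗ LinearMap.fst ℝ _ _ +
      (F p.1).mulVecLin ∘ₗ (LinearMap.snd ℝ _ _ - (A p.1).mulVecLin ∘ₗ LinearMap.fst ℝ _ _)
      ).continuous_of_finiteDimensional.measurable
  exact (measurable_pi_apply p.2).comp ((g.measurable_rule p.1).sub hlin)

/-- Adding and subtracting the candidate estimates separates a residual free of the strategy from a
deviation whose block `i` uses only what agent `i` observes. -/
theorem teamError_eq (S : Matrix (Σ i, Fin (dz i)) (Σ i, Fin (dz i)) ℝ)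
    (L : Matrix (Σ i, Fin (dz i)) (Fin dx) ℝ)
    (A0 : Matrix (Fin dx) (Fin d0) ℝ) (A : ∀ i, Matrix (Fin (dy i)) (Fin d0) ℝ)
    (F : ∀ i, Matrix (Fin (dz i)) (Fin (dy i)) ℝ) (g : Strategy d0 dy dz)
    (w : Fin dx → ℝ) (u : Fin d0 → ℝ) (v : ∀ i, Fin (dy i) → ℝ) :
    teamError S L w (fun i => g.rule i u (v i)) =
      (S *ᵥ ((L *ᵥ (w - A0 *ᵥ u) - gainVec F fun i => v i - A i *ᵥ u) -
        deviation L A0 A F g u v)) ⬝ᵥ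
      ((L *ᵥ (w - A0 *ᵥ u) - gainVec F fun i => v i - A i *ᵥ u) -
        deviation L A0 A F g u v) := by
  have h : (L *ᵥ w - fun p : Σ i, Fin (dz i) => g.rule p.1 u (v p.1) p.2) =
      (L *ᵥ (w - A0 *ᵥ u) - gainVec F fun i => v i - A i *ᵥ u) -
        deviation L A0 A F g u v := by
    ext p
    have hrow : (rowBlock L p.1 *ᵥ (A0 *ᵥ u)) p.2 = (L *ᵥ (A0 *ᵥ u)) p := rfl
    simp only [Matrix.mulVec_sub, Pi.sub_apply, gainVec, deviation, Pi.add_apply, hrow]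
    ring
  rw [teamError, h, dotProduct_comm]

/-- The expected error of a strategy is the one of the residual plus the one of its deviation. -/
theorem cost_eq [IsProbabilityMeasure P]
    (hx : Measurable x) (hy0 : Measurable y0) (hy : ∀ i, Measurable (y i))
    (hgauss : HasGaussianLaw (fun ω => (x ω, y0 ω, fun i => y i ω)) P)
    (hmean : ∫ ω, (x ω, y0 ω, fun i => y i ω) ∂P = 0) (hS : S.PosDef)
    {A0 : Matrix (Fin dx) (Fin d0) ℝ} {A : ∀ i, Matrix (Fin (dy i)) (Fin d0) ℝ}
    {F : ∀ i, Matrix (Fin (dz i)) (Fin (dy i)) ℝ}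
    (hr : ∀ p, MemLp (fun ω => (L *ᵥ (x ω - A0 *ᵥ y0 ω) -
      gainVec F fun i => y i ω - A i *ᵥ y0 ω) p) 2 P)
    (h0 : ∀ p k, ∫ ω, (S *ᵥ (L *ᵥ (x ω - A0 *ᵥ y0 ω) -
      gainVec F fun i => y i ω - A i *ᵥ y0 ω)) p * y0 ω k ∂P = 0)
    (h1 : ∀ i a b, ∫ ω, (S *ᵥ (L *ᵥ (x ω - A0 *ᵥ y0 ω) -
      gainVec F fun i => y i ω - A i *ᵥ y0 ω)) ⟨i, a⟩ * (y i ω - A i *ᵥ y0 ω) b ∂P = 0)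
    (g : Strategy d0 dy dz) :
    cost P S L x y0 y g =
      ENNReal.ofReal (∫ ω, (S *ᵥ (L *ᵥ (x ω - A0 *ᵥ y0 ω) -
        gainVec F fun i => y i ω - A i *ᵥ y0 ω)) ⬝ᵥ
          (L *ᵥ (x ω - A0 *ᵥ y0 ω) - gainVec F fun i => y i ω - A i *ᵥ y0 ω) ∂P) +
      ∫⁻ ω, ENNReal.ofReal ((S *ᵥ deviation L A0 A F g (y0 ω) fun i => y i ω) ⬝ᵥ
        deviation L A0 A F g (y0 ω) fun i => y i ω) ∂P := by
  simp only [cost, Strategy.estimate, teamError_eq S L A0 A F g]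
  refine lintegral_mulVec_dotProduct_sub hS hr (fun p => ?_) fun _ p => ?_
  · exact ((measurable_deviation_apply L A0 A F g p).comp
      (hy0.prodMk (hy p.1))).aestronglyMeasurable
  · exact integral_weightedResidual_mul_eq_zero hx hy0 hy hgauss hmean (h0 p) (h1 p.1 p.2)
      (measurable_deviation_apply L A0 A F g p)

theorem measurable_deviation (hy0 : Measurable y0) (hy : ∀ i, Measurable (y i))
    (A0 : Matrix (Fin dx) (Fin d0) ℝ) (A : ∀ i, Matrix (Fin (dy i)) (Fin d0) ℝ)
    (F : ∀ i, Matrix (Fin (dz i)) (Fin (dy i)) ℝ) (g : Strategy d0 dy dz) :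
    Measurable fun ω => deviation L A0 A F g (y0 ω) fun i => y i ω :=
  measurable_pi_lambda _ fun p =>
    (measurable_deviation_apply L A0 A F g p).comp (hy0.prodMk (hy p.1))

theorem lintegral_deviation_eq_zero_iff (hS : S.PosDef) (hy0 : Measurable y0)
    (hy : ∀ i, Measurable (y i))
    {A0 : Matrix (Fin dx) (Fin d0) ℝ} {A : ∀ i, Matrix (Fin (dy i)) (Fin d0) ℝ}
    (hx0 : commonEst P y0 x =ᵐ[P] fun ω => A0 *ᵥ y0 ω)
    (hy00 : ∀ i, innovation P y0 (y i) =ᵐ[P] fun ω => y i ω - A i *ᵥ y0 ω)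
    (F : ∀ i, Matrix (Fin (dz i)) (Fin (dy i)) ℝ) (g : Strategy d0 dy dz) :
    ∫⁻ ω, ENNReal.ofReal ((S *ᵥ deviation L A0 A F g (y0 ω) fun i => y i ω) ⬝ᵥ
        deviation L A0 A F g (y0 ω) fun i => y i ω) ∂P = 0 ↔ HasGains P L x y0 y g F := by
  have hm : Measurable fun ω => deviation L A0 A F g (y0 ω) fun i => y i ω :=
    measurable_deviation hy0 hy A0 A F g
  have hSm : Measurable fun ω => S *ᵥ deviation L A0 A F g (y0 ω) fun i => y i ω :=
    S.mulVecLin.continuous_of_finiteDimensional.measurable.comp hm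
  have hqm : Measurable fun ω => (S *ᵥ deviation L A0 A F g (y0 ω) fun i => y i ω) ⬝ᵥ
      deviation L A0 A F g (y0 ω) fun i => y i ω :=
    Finset.measurable_fun_sum _ fun p _ =>
      ((measurable_pi_apply p).comp hSm).mul ((measurable_pi_apply p).comp hm)
  rw [lintegral_eq_zero_iff hqm.ennreal_ofReal]
  constructor
  · intro h i
    filter_upwards [h, hx0, hy00 i] with ω hω h1 h2
    have hd := posDef_eq_zero_of_mulVec_dotProduct hS
      (le_antisymm (ENNReal.ofReal_eq_zero.1 hω) (posDef_mulVec_dotProduct_nonneg hS _))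
    ext a
    rw [h1, h2, ← sub_eq_zero]
    exact congrFun hd ⟨i, a⟩
  · intro h
    filter_upwards [ae_all_iff.2 h, hx0, ae_all_iff.2 hy00] with ω hω h1 h2
    have hd : (deviation L A0 A F g (y0 ω) fun i => y i ω) = 0 := by
      ext ⟨i, a⟩
      have := congrFun (hω i) a
      rw [h1, h2, ← sub_eq_zero] at this
      exact this
    simp [hd]

/-- The linear strategy with estimates `Lᵢ A₀ y₀ + Fᵢ (yᵢ - Aᵢ y₀)`. -/
def linearStrategy (L : Matrix (Σ i, Fin (dz i)) (Fin dx) ℝ) (A0 : Matrix (Fin dx) (Fin d0) ℝ)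
    (A : ∀ i, Matrix (Fin (dy i)) (Fin d0) ℝ) (F : ∀ i, Matrix (Fin (dz i)) (Fin (dy i)) ℝ) :
    Strategy d0 dy dz where
  rule i u v := (rowBlock L i * A0 - F i * A i) *ᵥ u + F i *ᵥ v
  measurable_rule i :=
    ((rowBlock L i * A0 - F i * A i).mulVecLin ∘ₗ LinearMap.fst ℝ _ _ +
      (F i).mulVecLin ∘ₗ LinearMap.snd ℝ _ _).continuous_of_finiteDimensional.measurable

theorem linearStrategy_hasGains {A0 : Matrix (Fin dx) (Fin d0) ℝ}
    {A : ∀ i, Matrix (Fin (dy i)) (Fin d0) ℝ}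
    (hx0 : commonEst P y0 x =ᵐ[P] fun ω => A0 *ᵥ y0 ω)
    (hy00 : ∀ i, innovation P y0 (y i) =ᵐ[P] fun ω => y i ω - A i *ᵥ y0 ω)
    (F : ∀ i, Matrix (Fin (dz i)) (Fin (dy i)) ℝ) :
    HasGains P L x y0 y (linearStrategy L A0 A F) F := by
  intro i
  filter_upwards [hx0, hy00 i] with ω h1 h2
  rw [h1, h2]
  simp only [Strategy.estimate, linearStrategy, Matrix.sub_mulVec, Matrix.mulVec_sub,
    Matrix.mulVec_mulVec]
  abel

end Innovations

end TeamEstimation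

open TeamEstimation

/-! ### Optimal strategies and the minimum cost -/

theorem theorem1 {Ω : Type*} [MeasurableSpace Ω] (P : Measure Ω) [IsProbabilityMeasure P]
    {n dx d0 : ℕ} {dy dz : Fin n → ℕ}
    (x : Ω → Fin dx → ℝ) (y0 : Ω → Fin d0 → ℝ) (y : ∀ i, Ω → Fin (dy i) → ℝ)
    (hx : Measurable x) (hy0 : Measurable y0) (hy : ∀ i, Measurable (y i))
    (hgauss : HasGaussianLaw (fun ω => (x ω, y0 ω, fun i => y i ω)) P)
    (hx_mean : ∫ ω, x ω ∂P = 0) (hy0_mean : ∫ ω, y0 ω ∂P = 0)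
    (hy_mean : ∀ i, ∫ ω, y i ω ∂P = 0)
    (S : Matrix (Σ i, Fin (dz i)) (Σ i, Fin (dz i)) ℝ) (hS : S.PosDef)
    (L : Matrix (Σ i, Fin (dz i)) (Fin dx) ℝ) :
    -- the gain equations are solvable, and each solution gives an optimal linear strategy
    (∃ F, TeamEstimation.SolvesGainEq P S L x y0 y F) ∧
    (∀ F, TeamEstimation.SolvesGainEq P S L x y0 y F →
      ∃ g : TeamEstimation.Strategy d0 dy dz, g.IsLinear ∧
        TeamEstimation.IsOptimal P S L x y0 y g ∧ TeamEstimation.HasGains P L x y0 y g F) ∧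
    -- every optimal strategy has this form, with gains that solve the equations
    (∀ g : TeamEstimation.Strategy d0 dy dz, TeamEstimation.IsOptimal P S L x y0 y g →
      ∀ F, TeamEstimation.HasGains P L x y0 y g F ↔
        TeamEstimation.SolvesGainEq P S L x y0 y F) ∧
    -- non-degenerate innovations: unique gains in closed form, and the minimum cost
    ((∀ i, (TeamEstimation.SigmaHat P y0 y i i).PosDef) →
      IsUnit (TeamEstimation.Gam P S y0 y) ∧
      (∃! F, TeamEstimation.SolvesGainEq P S L x y0 y F) ∧
      (∀ F, TeamEstimation.SolvesGainEq P S L x y0 y F →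
        TeamEstimation.stackVec F =
          (TeamEstimation.Gam P S y0 y)⁻¹ *ᵥ TeamEstimation.eta P S L x y0 y) ∧
      0 ≤ (Lᵀ * S * L * TeamEstimation.errorCov P x y0).trace
        - TeamEstimation.eta P S L x y0 y ⬝ᵥ
          ((TeamEstimation.Gam P S y0 y)⁻¹ *ᵥ TeamEstimation.eta P S L x y0 y) ∧
      TeamEstimation.minCost P S L x y0 y = ENNReal.ofReal
        ((Lᵀ * S * L * TeamEstimation.errorCov P x y0).trace
          - TeamEstimation.eta P S L x y0 y ⬝ᵥ
            ((TeamEstimation.Gam P S y0 y)⁻¹ *ᵥ TeamEstimation.eta P S L x y0 y))) := by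
  have hmean := integral_measurements_eq_zero hgauss hx_mean hy0_mean hy_mean
  set W : Ω → (Fin dx → ℝ) × (Fin d0 → ℝ) × (∀ i, Fin (dy i) → ℝ) :=
    fun ω => (x ω, y0 ω, fun i => y i ω)
  have hW : Measurable W := hx.prodMk (hy0.prodMk (measurable_pi_lambda _ hy))
  let T : ((Fin dx → ℝ) × (Fin d0 → ℝ) × (∀ i, Fin (dy i) → ℝ)) →ₗ[ℝ] (Fin dx → ℝ) :=
    LinearMap.fst ℝ _ _
  let U : ((Fin dx → ℝ) × (Fin d0 → ℝ) × (∀ i, Fin (dy i) → ℝ)) →ₗ[ℝ] (Fin d0 → ℝ) :=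
    LinearMap.fst ℝ _ _ ∘ₗ LinearMap.snd ℝ _ _
  let V (i : Fin n) :
      ((Fin dx → ℝ) × (Fin d0 → ℝ) × (∀ i, Fin (dy i) → ℝ)) →ₗ[ℝ] (Fin (dy i) → ℝ) :=
    LinearMap.proj i ∘ₗ LinearMap.snd ℝ _ _ ∘ₗ LinearMap.snd ℝ _ _
  obtain ⟨A0, hA0⟩ := exists_integral_sub_mulVec_mul_eq_zero hgauss T U
  choose A hA using fun i => exists_integral_sub_mulVec_mul_eq_zero hgauss (V i) U
  have hx0 : commonEst P y0 x =ᵐ[P] fun ω => A0 *ᵥ y0 ω :=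
    condExp_linearMap_ae_eq hW hgauss hmean T U A0 hA0
  have hxi := innovation_ae_eq_sub_mulVec hx0
  have hy00 (i : Fin n) : innovation P y0 (y i) =ᵐ[P] fun ω => y i ω - A i *ᵥ y0 ω :=
    innovation_ae_eq_sub_mulVec (condExp_linearMap_ae_eq hW hgauss hmean (V i) U (A i) (hA i))
  let TX := T - A0.mulVecLin ∘ₗ U
  let VY (i : Fin n) := V i - (A i).mulVecLin ∘ₗ U
  let X : Ω → Fin dx → ℝ := fun ω => x ω - A0 *ᵥ y0 ω
  let Y : ∀ i, Ω → Fin (dy i) → ℝ := fun i ω => y i ω - A i *ᵥ y0 ω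
  have hx2 (e) : MemLp (fun ω => x ω e) 2 P := memLp_two_linearMap hgauss (LinearMap.proj e ∘ₗ T)
  have hu2 (k) : MemLp (fun ω => y0 ω k) 2 P := memLp_two_linearMap hgauss (LinearMap.proj k ∘ₗ U)
  have hX (e) : MemLp (fun ω => X ω e) 2 P := memLp_two_linearMap hgauss (LinearMap.proj e ∘ₗ TX)
  have hY (i) (b) : MemLp (fun ω => Y i ω b) 2 P :=
    memLp_two_linearMap hgauss (LinearMap.proj b ∘ₗ VY i)
  have hX0 (e) : ∫ ω, X ω e ∂P = 0 :=
    integral_linearMap_eq_zero hgauss hmean (LinearMap.proj e ∘ₗ TX)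
  have hY0 (i) (b) : ∫ ω, Y i ω b ∂P = 0 :=
    integral_linearMap_eq_zero hgauss hmean (LinearMap.proj b ∘ₗ VY i)
  have hXu (e k) : ∫ ω, X ω e * y0 ω k ∂P = 0 := hA0 e k
  have hYu (i b k) : ∫ ω, Y i ω b * y0 ω k ∂P = 0 := hA i b k
  have hSig (i j) : SigmaHat P y0 y i j = secondMoment P (Y i) (Y j) :=
    crossCov_eq_secondMoment (hy00 i) (hy00 j) (hY i) (hY j) (hY0 i)
  have herr : errorCov P x y0 = secondMoment P X X :=
    crossCov_eq_secondMoment hxi hxi hX hX hX0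
  -- The state may be replaced by its innovation `X`, since the difference `A₀ y₀` is uncorrelated
  -- with `Yᵢ`.
  have hTheta (i) : ThetaHat P x y0 y i = secondMoment P X (Y i) := by
    rw [ThetaHat, crossCov_eq_secondMoment Filter.EventuallyEq.rfl (hy00 i) hx2 (hY i)
      fun e => integral_linearMap_eq_zero hgauss hmean (LinearMap.proj e ∘ₗ T)]
    ext e b
    have hz : ∫ ω, (A0 *ᵥ y0 ω) e * Y i ω b ∂P = 0 := by
      rw [integral_mulVec_mul hu2 (hY i b)]
      refine Finset.sum_eq_zero fun k _ => ?_
      simp_rw [mul_comm (y0 _ k)]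
      rw [hYu, mul_zero]
    have hs : ∫ ω, X ω e * Y i ω b ∂P =
        ∫ ω, x ω e * Y i ω b ∂P - ∫ ω, (A0 *ᵥ y0 ω) e * Y i ω b ∂P := by
      rw [← integral_sub (integrable_fun_mul (hx2 e) (hY i b))
        (integrable_fun_mul (memLp_mulVec hu2 A0 e) (hY i b))]
      simp only [X, Pi.sub_apply, sub_mul]
    rw [hz, sub_zero] at hs
    exact hs.symm
  have hr (F : ∀ i, Matrix (Fin (dz i)) (Fin (dy i)) ℝ) (p) :
      MemLp (fun ω => (L *ᵥ X ω - gainVec F fun i => Y i ω) p) 2 P :=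
    (memLp_mulVec hX L p).sub (memLp_gainVec hY F p)
  have hru (F : ∀ i, Matrix (Fin (dz i)) (Fin (dy i)) ℝ) (p k) :
      ∫ ω, (S *ᵥ (L *ᵥ X ω - gainVec F fun i => Y i ω)) p * y0 ω k ∂P = 0 := by
    rw [integral_mulVec_mul (hr F) (hu2 k)]
    refine Finset.sum_eq_zero fun q _ => ?_
    simp only [Pi.sub_apply, sub_mul]
    rw [integral_sub (integrable_fun_mul (memLp_mulVec hX L q) (hu2 k))
      (integrable_fun_mul (memLp_gainVec hY F q) (hu2 k)), integral_mulVec_mul hX (hu2 k)]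
    have : ∫ ω, gainVec F (fun i => Y i ω) q * y0 ω k ∂P = 0 := by
      refine (integral_mulVec_mul (hY q.1) (hu2 k) (F q.1) q.2).trans ?_
      simp only [hYu, mul_zero, Finset.sum_const_zero]
    rw [this]
    simp only [hXu, mul_zero, Finset.sum_const_zero, sub_zero]
  have hcost {F} (hF : SolvesGainEq P S L x y0 y F) (g : Strategy d0 dy dz) :=
    cost_eq hx hy0 hy hgauss hmean hS (hr F) (hru F)
      (hF.integral_residual_mul hX hY hSig hTheta) g
  have hzero (F) (g : Strategy d0 dy dz) :=
    lintegral_deviation_eq_zero_iff (L := L) hS hy0 hy hx0 hy00 F g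
  have hlin (F) : HasGains P L x y0 y (linearStrategy L A0 A F) F :=
    linearStrategy_hasGains hx0 hy00 F
  have hmin {F} (hF : SolvesGainEq P S L x y0 y F) {g : Strategy d0 dy dz}
      (hg : HasGains P L x y0 y g F) : cost P S L x y0 y g =
        ENNReal.ofReal (∫ ω, (S *ᵥ (L *ᵥ X ω - gainVec F fun i => Y i ω)) ⬝ᵥ
          (L *ᵥ X ω - gainVec F fun i => Y i ω) ∂P) := by
    rw [hcost hF, (hzero F g).2 hg, add_zero]
  have hopt {F} (hF : SolvesGainEq P S L x y0 y F) (g : Strategy d0 dy dz) :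
      IsOptimal P S L x y0 y g ↔ HasGains P L x y0 y g F := by
    constructor
    · intro h
      have := h (linearStrategy L A0 A F)
      rw [hmin hF (hlin F), hcost hF] at this
      rw [← hzero]
      -- The residual cost is finite, so it cancels in `[0, ∞]`.
      exact nonpos_iff_eq_zero.1 ((ENNReal.add_le_add_iff_left ENNReal.ofReal_ne_top).1
        (this.trans_eq (add_zero _).symm))
    · intro h g'
      rw [hmin hF h, hcost hF g']
      exact le_self_add
  obtain ⟨F₀, hF₀⟩ := exists_solvesGainEq (L := L) hS hX hY hSig hTheta
  refine ⟨⟨F₀, hF₀⟩, fun F hF => ⟨linearStrategy L A0 A F, ⟨_, _, fun _ _ _ => rfl⟩,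
    (hopt hF _).2 (hlin F), hlin F⟩, fun g hg F => ⟨fun h => ?_, fun hF => (hopt hF g).1 hg⟩,
    fun hpos => ?_⟩
  -- The estimates of `g` have gains `F` and `F₀`, so `F Y = F₀ Y` almost surely. `Γ` sees gains
  -- only through `F Y`, so `F` solves the same system.
  · have h₀ := (hopt hF₀ g).1 hg
    rw [solvesGainEq_iff hSig] at hF₀ ⊢
    rw [← hF₀]
    ext q
    rw [Gam_mulVec_stackVec hY hSig, Gam_mulVec_stackVec hY hSig]
    refine integral_congr_ae ?_
    filter_upwards [ae_all_iff.2 h, ae_all_iff.2 h₀, ae_all_iff.2 hy00] with ω h1 h2 h3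
    have : (gainVec F fun i => Y i ω) = gainVec F₀ fun i => Y i ω := by
      ext p
      have := add_left_cancel ((h1 p.1).symm.trans (h2 p.1))
      rw [h3] at this
      exact congrFun this p.2
    rw [this]
  · have hunit := isUnit_Gam hS hY hSig hpos
    have hdet := (Matrix.isUnit_iff_isUnit_det _).1 hunit
    have hsol {F} (hF : SolvesGainEq P S L x y0 y F) :
        stackVec F = (Gam P S y0 y)⁻¹ *ᵥ eta P S L x y0 y := by
      rw [← (solvesGainEq_iff hSig F).1 hF, Matrix.mulVec_mulVec, Matrix.nonsing_inv_mul _ hdet,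
        Matrix.one_mulVec]
    have hval := hF₀.integral_residual hX hY hS hSig hTheta
    rw [hsol hF₀, ← herr] at hval
    refine ⟨hunit, ⟨F₀, hF₀, fun F hF => stackVec_bijective.1 ((hsol hF).trans (hsol hF₀).symm)⟩,
      fun F hF => hsol hF, ?_, ?_⟩
    · rw [← hval]
      exact integral_nonneg fun ω => posDef_mulVec_dotProduct_nonneg hS _
    · rw [← hval, ← hmin hF₀ (hlin F₀)]
      exact le_antisymm (iInf_le _ _) (le_iInf ((hopt hF₀ _).2 (hlin F₀)))
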